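/- Let $n,k\ge 0$ be integers, let $f_0,\dots,f_k:\mathbb R^n\to[-\infty,\infty]$ be proper convex functions (never $-\infty$, not identically $+\infty$) and let $x^\star\in\mathbb R^n$. Write $$\partial f_i(x^\star)=\{u: f_i(x^\star+t)\ge f_i(x^\star)+\langle u,t\rangle\ \text{for all } t\in\mathbb R^n\},\qquad D(f_i,x^\star)=\{d:\exists a>0,\ f_i(x^\star+a d)\le f_i(x^\star)\}$$ for the subdifferential and the descent cone of $f_i$ at $x^\star$, and let $$C=\{u\in\mathbb R^n:\exists t>0,\ f_i(x^\star+t u)\le f_i(x^\star)\ \text{for } i=0,\dots,k\}$$ be the prior restricted cone. For a convex cone $K$ let $\delta(K)=\mathbb E\big(\sup_{t\in K,\ \|t\|_2\le 1}\langle g,t\rangle\big)^2$ be its statistical dimension, where $g\sim N(0,I_n)$. Assume that for every $0\le i\le k$ the set $\partial f_i(x^\star)$ is non-empty, compact and does not contain $0$, and that the relative interiors of $D(f_0,x^\star),\dots,D(f_k,x^\star)$ have a common point. Let $\mathbb R^{k+1}_+=\{\tau\in\mathbb R^{k+1}:\tau_i\ge 0 \text{ for all } i\}$ and define $$J:\mathbb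 R^{k+1}_+\to\mathbb R,\qquad J(\tau)=\mathbb E\Big[\operatorname{dist}^2\Big(g,\sum_{i=0}^k\tau_i\,\partial f_i(x^\star)\Big)\Big],$$ where the sum is the Minkowski sum. Then the expectations defining $\delta(C)$ and $J(\tau)$, $\tau\in\mathbb R^{k+1}_+$, are finite, and: 1. $\delta(C)\le\inf_{\tau\in\mathbb R^{k+1}_+}J(\tau)$. 2. $J$ is convex, continuous and continuously differentiable on $\mathbb R^{k+1}_+$: there is a continuous map $G:\mathbb R^{k+1}_+\to\mathbb R^{k+1}$ such that $G(\tau)$ is the gradient of $J$ at $\tau$ relative to $\mathbb R^{k+1}_+$, and $G_i(\tau)$ is the partial derivative $\partial J/\partial\tau_i$ at $\tau$, interpreted as the right derivative if $\tau_i=0$. 3. $J$ attains its minimum over $\mathbb R^{k+1}_+$, and all its minimizers lie in a compact subset of $\mathbb R^{k+1}_+$. 4. If moreover $\sum_i\tau_i\,\partial f_i(x^\star)\ne\sum_i\tilde\tau_i\,\partial f_i(x^\star)$ for all $\tau\ne\tilde\tau$ in $\mathbb R^{k+1}_+$, then $J$ is strictly convex on $\mathbb R^{k+1}_+$ and attains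 its minimum over $\mathbb R^{k+1}_+$ at exactly one point. -/

import Mathlib

open MeasureTheory ProbabilityTheory Set
open scoped Pointwise

noncomputable section

namespace PriorCone

/-- Proper convex function `ℝⁿ → [-∞, ∞]`: the epigraph is convex, the value `-∞` is never taken
and the function is not identically `+∞`. -/
structure IsProperConvex {n : ℕ} (f : EuclideanSpace ℝ (Fin n) → EReal) : Prop where
  convex_epigraph : Convex ℝ {p : EuclideanSpace ℝ (Fin n) × ℝ | f p.1 ≤ (p.2 : EReal)}
  ne_bot : ∀ x, f x ≠ ⊥
  exists_ne_top : ∃ x, f x ≠ ⊤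

/-- The subdifferential `∂f(z)`. -/
def subdiff {n : ℕ} (f : EuclideanSpace ℝ (Fin n) → EReal) (z : EuclideanSpace ℝ (Fin n)) :
    Set (EuclideanSpace ℝ (Fin n)) :=
  {u | ∀ t : EuclideanSpace ℝ (Fin n), f z + ((inner ℝ u t : ℝ) : EReal) ≤ f (z + t)}

/-- The descent cone `D(f, z)`. -/
def descentCone {n : ℕ} (f : EuclideanSpace ℝ (Fin n) → EReal) (z : EuclideanSpace ℝ (Fin n)) :
    Set (EuclideanSpace ℝ (Fin n)) :=
  {d | ∃ a : ℝ, 0 < a ∧ f (z + a • d) ≤ f z}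

/-- The prior restricted set: the directions in which no `f i` increases. -/
def priorRestrictedSet {n k : ℕ} (f : Fin (k + 1) → EuclideanSpace ℝ (Fin n) → EReal)
    (x : EuclideanSpace ℝ (Fin n)) : Set (EuclideanSpace ℝ (Fin n)) :=
  {d | ∀ i, f i (x + d) ≤ f i x}

/-- The prior restricted cone: the cone generated by the prior restricted set. -/
def priorRestrictedCone {n k : ℕ} (f : Fin (k + 1) → EuclideanSpace ℝ (Fin n) → EReal)
    (x : EuclideanSpace ℝ (Fin n)) : Set (EuclideanSpace ℝ (Fin n)) :=
  {u | ∃ t : ℝ, 0 < t ∧ t • u ∈ priorRestrictedSet f x}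

/-- `sup_{t ∈ K ∩ Bⁿ} ⟨g, t⟩`, where `Bⁿ` is the closed unit ball. -/
def supInnerBall {n : ℕ} (K : Set (EuclideanSpace ℝ (Fin n))) (g : EuclideanSpace ℝ (Fin n)) : ℝ :=
  sSup ((fun t => inner ℝ g t) '' (K ∩ Metric.closedBall 0 1))

/-- The statistical dimension `δ(K) = 𝔼 (sup_{t ∈ K ∩ Bⁿ} ⟨g, t⟩)²`, `g ∼ N(0, Iₙ)`. -/
def statDim {n : ℕ} (K : Set (EuclideanSpace ℝ (Fin n))) : ℝ :=
  ∫ g, supInnerBall K g ^ 2 ∂(stdGaussian (EuclideanSpace ℝ (Fin n)))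

/-- The non-negative orthant of `ℝᵐ`. -/
def orthant (m : ℕ) : Set (EuclideanSpace ℝ (Fin m)) :=
  {τ | ∀ i, 0 ≤ τ i}

/-- The Minkowski sum `∑ i, τ i • ∂(f i)(x)`. -/
def sumSubdiff {n k : ℕ} (f : Fin (k + 1) → EuclideanSpace ℝ (Fin n) → EReal)
    (x : EuclideanSpace ℝ (Fin n)) (τ : EuclideanSpace ℝ (Fin (k + 1))) :
    Set (EuclideanSpace ℝ (Fin n)) :=
  ∑ i, τ i • subdiff (f i) x

/-- `J(τ) = 𝔼 dist²(g, ∑ i, τ i • ∂(f i)(x))`, `g ∼ N(0, Iₙ)`. -/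
def J {n k : ℕ} (f : Fin (k + 1) → EuclideanSpace ℝ (Fin n) → EReal)
    (x : EuclideanSpace ℝ (Fin n)) (τ : EuclideanSpace ℝ (Fin (k + 1))) : ℝ :=
  ∫ g, Metric.infDist g (sumSubdiff f x τ) ^ 2 ∂(stdGaussian (EuclideanSpace ℝ (Fin n)))

/-- `D` is the `i`-th partial derivative of `F` at the point `τ` of the orthant: the usual one if
`τ i > 0`, the right derivative if `τ i = 0`. -/
def HasOrthantPartial {m : ℕ} (F : EuclideanSpace ℝ (Fin m) → ℝ) (i : Fin m) (D : ℝ)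
    (τ : EuclideanSpace ℝ (Fin m)) : Prop :=
  (0 < τ i → HasDerivAt (fun s : ℝ => F (τ + s • EuclideanSpace.single i (1 : ℝ))) D 0) ∧
  (τ i = 0 → HasDerivWithinAt (fun s : ℝ => F (τ + s • EuclideanSpace.single i (1 : ℝ))) D
    (Ici 0) 0)

/-- `F` is continuously differentiable on the orthant: it has a continuous gradient there
(derivatives being taken within the orthant), whose coordinates are the partial derivatives,
one-sided on the boundary. -/
def IsC1OnOrthant {m : ℕ} (F : EuclideanSpace ℝ (Fin m) → ℝ) : Prop :=
  ∃ G : EuclideanSpace ℝ (Fin m) → EuclideanSpace ℝ (Fin m),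
    ContinuousOn G (orthant m) ∧
    ∀ τ ∈ orthant m, HasGradientWithinAt F (G τ) (orthant m) τ ∧
      ∀ i, HasOrthantPartial F i (G τ i) τ

end PriorCone

end

/-! Write S_i for the i-th subdifferential, P_τ for the sum of the τ_i S_i and h_i for the support
function of S_i.

The bound on the statistical dimension is polarity: subgradients have non-positive inner product
with descent directions, so ⟨g, t⟩ ≤ ⟨g - s, t⟩ ≤ ‖g - s‖ for s ∈ P_τ and t in the cone with ‖t‖ ≤
1.

Regularity comes from duality. For τ ≥ 0, dist²(g, P_τ) is the maximum over w of 2⟨w, g⟩ - ‖w‖² - 2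
∑ τ_i h_i(w), attained at the residual w of the projection of g (`dualObj_le`, `dualObj_residual`).
The objective is affine in τ, so -2 h_i(w) are the coordinates of a subgradient; it is strongly
concave in w, so the residual is Lipschitz in (g, τ). Integration yields a continuous selection of
subgradients of J, which must be its gradient. No differentiation under the integral sign is needed.

Coercivity comes from the common relative interior point d: it satisfies ⟨u, d⟩ ≤ -c < 0 for all u
in all S_i, so the points of P_τ have norm growing linearly in τ. The underlying fact is
`mem_descentCone_of_forall_inner_neg`, obtained by separating the epigraph from a horizontal ray.

For strict convexity, a point lying in just one of P_τ and P_σ makes the convexity inequality strict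
at that point, and the Gaussian charges each of its neighbourhoods. -/

namespace PriorCone

/-! ### Weak separation and relative interiors -/

section Separation

/-- A convex set in a finite-dimensional space can be weakly separated from any point outside. -/
theorem exists_ne_zero_forall_nonneg_of_zero_notMem {V : Type*} [NormedAddCommGroup V]
    [NormedSpace ℝ V] [FiniteDimensional ℝ V] {K : Set V} (hK : Convex ℝ K) (hne : K.Nonempty)
    (h0 : (0 : V) ∉ K) : ∃ φ : V →L[ℝ] ℝ, φ ≠ 0 ∧ ∀ y ∈ K, 0 ≤ φ y := by
  by_cases hint : (interior K).Nonempty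
  · obtain ⟨φ, u, hφ, hle, hge⟩ := geometric_hahn_banach_of_nonempty_interior hK
      (convex_singleton (0 : V)) (disjoint_singleton_right.2 fun h => h0 (interior_subset h)) hint
      (singleton_nonempty 0)
    refine ⟨-φ, neg_ne_zero.2 hφ, fun y hy => ?_⟩
    have h1 := hle y hy
    have h2 := hge 0 rfl
    simp only [map_zero] at h2
    simp only [neg_apply]
    linarith
  -- Without interior points, `K` lies in a proper affine subspace; a functional vanishing on its
  -- direction is constant on `K`, and its sign can be chosen.
  · rw [hK.interior_nonempty_iff_affineSpan_eq_top] at hint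
    obtain ⟨y₀, hy₀⟩ := hne
    have hlt : (affineSpan ℝ K).direction < ⊤ := by
      refine lt_top_iff_ne_top.2 fun h => hint ?_
      exact (AffineSubspace.direction_eq_top_iff_of_nonempty
        ⟨y₀, subset_affineSpan ℝ K hy₀⟩).1 h
    obtain ⟨ψ, hψ, hker⟩ := Submodule.exists_le_ker_of_lt_top _ hlt
    have hconst : ∀ y ∈ K, ψ y = ψ y₀ := fun y hy => by
      have : y -ᵥ y₀ ∈ (affineSpan ℝ K).direction :=
        AffineSubspace.vsub_mem_direction (subset_affineSpan ℝ K hy) (subset_affineSpan ℝ K hy₀)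
      have := hker this
      rw [LinearMap.mem_ker, vsub_eq_sub, map_sub] at this
      linarith
    have hψ' : LinearMap.toContinuousLinearMap ψ ≠ 0 := fun h => hψ (by
      ext v
      exact DFunLike.congr_fun h v)
    rcases le_total 0 (ψ y₀) with h | h
    · exact ⟨LinearMap.toContinuousLinearMap ψ, hψ', fun y hy => by simpa [hconst y hy] using h⟩
    · exact ⟨-LinearMap.toContinuousLinearMap ψ, neg_ne_zero.2 hψ', fun y hy => by
        simpa [hconst y hy] using h⟩

/-- A segment in a set ending at a relative interior point can be prolonged inside the set. -/
theorem exists_pos_add_smul_sub_mem_of_mem_intrinsicInterior {V : Type*} [NormedAddCommGroup V]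
    [NormedSpace ℝ V] {D : Set V} {d e : V} (hd : d ∈ intrinsicInterior ℝ D) (he : e ∈ D) :
    ∃ ε : ℝ, 0 < ε ∧ d + ε • (d - e) ∈ D := by
  obtain ⟨⟨y, hyD⟩, hy, rfl⟩ := mem_intrinsicInterior.1 hd
  have hmem : ∀ t : ℝ, y + t • (y - e) ∈ affineSpan ℝ D := fun t => by
    have := AffineMap.lineMap_mem (-t) hyD (subset_affineSpan ℝ D he)
    convert this using 1
    simp only [AffineMap.lineMap_apply, vsub_eq_sub, vadd_eq_add]
    module
  let γ : ℝ → affineSpan ℝ D := fun t => ⟨y + t • (y - e), hmem t⟩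
  have hγ : Continuous γ := by
    refine Continuous.subtype_mk ?_ _
    fun_prop
  have hγ0 : γ 0 = ⟨y, hyD⟩ := by simp [γ]
  have h1 : γ ⁻¹' (Subtype.val ⁻¹' D) ∈ nhds (0 : ℝ) := by
    refine hγ.continuousAt.preimage_mem_nhds ?_
    rw [hγ0]
    exact mem_interior_iff_mem_nhds.1 hy
  obtain ⟨ε, hε, hball⟩ := Metric.mem_nhds_iff.1 h1
  refine ⟨ε / 2, by linarith, ?_⟩
  have : (ε / 2) ∈ Metric.ball (0 : ℝ) ε := by
    rw [mem_ball_zero_iff, Real.norm_eq_abs, abs_of_pos (by linarith)]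
    linarith
  exact hball this

end Separation

/-! ### Subgradients and descent directions -/

section Subdifferential

variable {n : ℕ} {f : EuclideanSpace ℝ (Fin n) → EReal} {z : EuclideanSpace ℝ (Fin n)}

theorem IsProperConvex.exists_coe_eq (hf : IsProperConvex f) (hne : (subdiff f z).Nonempty) :
    ∃ r : ℝ, f z = r := by
  have htop : f z ≠ ⊤ := fun h => by
    obtain ⟨u, hu⟩ := hne
    obtain ⟨y, hy⟩ := hf.exists_ne_top
    have := hu (y - z)
    rw [h, EReal.top_add_coe, add_sub_cancel, top_le_iff] at this
    exact hy this
  exact ⟨(f z).toReal, (EReal.coe_toReal htop (hf.ne_bot z)).symm⟩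

/-- Subgradients described by real affine minorants. -/
theorem mem_subdiff_iff {r : ℝ} (hr : f z = r) {u : EuclideanSpace ℝ (Fin n)} :
    u ∈ subdiff f z ↔
      ∀ (y : EuclideanSpace ℝ (Fin n)) (s : ℝ), f y ≤ s → r + inner ℝ u (y - z) ≤ s := by
  constructor
  · intro hu y s hs
    have := (hu (y - z)).trans ((congrArg f (add_sub_cancel z y)).le.trans hs)
    rw [hr] at this
    exact_mod_cast this
  · intro h t
    rw [hr, ← EReal.coe_add]
    refine EReal.le_of_forall_lt_iff_le.1 fun s hs => ?_
    have := h (z + t) s hs.le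
    rw [add_sub_cancel_left] at this
    exact_mod_cast this

theorem IsProperConvex.convex_subdiff (hf : IsProperConvex f) : Convex ℝ (subdiff f z) := by
  intro u hu v hv a b ha hb hab
  obtain ⟨r, hr⟩ := hf.exists_coe_eq ⟨u, hu⟩
  rw [mem_subdiff_iff hr] at hu hv ⊢
  intro y s hs
  have h1 := mul_le_mul_of_nonneg_left (hu y s hs) ha
  have h2 := mul_le_mul_of_nonneg_left (hv y s hs) hb
  rw [inner_add_left, real_inner_smul_left, real_inner_smul_left]
  have hr' : r = a * r + b * r := by rw [← add_mul, hab, one_mul]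
  have hs' : s = a * s + b * s := by rw [← add_mul, hab, one_mul]
  linarith

theorem inner_nonpos_of_mem_descentCone (hf : IsProperConvex f)
    {u d : EuclideanSpace ℝ (Fin n)} (hu : u ∈ subdiff f z) (hd : d ∈ descentCone f z) :
    inner ℝ u d ≤ 0 := by
  obtain ⟨r, hr⟩ := hf.exists_coe_eq ⟨u, hu⟩
  obtain ⟨a, ha, h⟩ := hd
  have := (mem_subdiff_iff hr).1 hu (z + a • d) r (hr ▸ h)
  rw [add_sub_cancel_left, real_inner_smul_right] at this
  by_contra! h'
  nlinarith [mul_pos ha h']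

/-- If the subdifferential is non-empty and bounded, then every direction that makes a negative
inner product with all the subgradients is a descent direction. -/
theorem mem_descentCone_of_forall_inner_neg (hf : IsProperConvex f)
    (hne : (subdiff f z).Nonempty) (hbd : Bornology.IsBounded (subdiff f z))
    {v : EuclideanSpace ℝ (Fin n)} (hv : ∀ u ∈ subdiff f z, inner ℝ u v < 0) :
    v ∈ descentCone f z := by
  obtain ⟨r, hr⟩ := hf.exists_coe_eq hne
  by_contra hnot
  let epi : Set (EuclideanSpace ℝ (Fin n) × ℝ) := {p | f p.1 ≤ (p.2 : EReal)}
  -- If `v` is not a descent direction, the open horizontal ray from `(z, f z)` along `v` misses the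
  -- epigraph. Weak separation suffices, so `f` need not be lower semicontinuous.
  let ray : Set (EuclideanSpace ℝ (Fin n) × ℝ) := (fun a : ℝ => (z, r) + a • (v, (0 : ℝ))) '' Ioi 0
  have hray : Convex ℝ ray := by
    rintro _ ⟨a, ha, rfl⟩ _ ⟨b, hb, rfl⟩ s t hs ht hst
    refine ⟨s * a + t * b, (convex_Ioi (0 : ℝ)) ha hb hs ht hst, ?_⟩
    have : t = 1 - s := by linarith
    subst this
    module
  have hmem : ∀ (y : EuclideanSpace ℝ (Fin n)) (s a : ℝ), f y ≤ s → 0 < a →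
      (y - z - a • v, s - r) ∈ epi - ray := fun y s a hy ha => by
    refine ⟨(y, s), hy, _, ⟨a, ha, rfl⟩, ?_⟩
    ext1
    · simp [sub_sub]
    · simp
  have h0 : (0 : EuclideanSpace ℝ (Fin n) × ℝ) ∉ epi - ray := by
    rintro ⟨p, hp, _, ⟨a, ha, rfl⟩, h⟩
    refine hnot ⟨a, ha, ?_⟩
    obtain rfl : p = (z, r) + a • (v, (0 : ℝ)) := sub_eq_zero.1 h
    have : f (z + a • v) ≤ ((r + a • (0 : ℝ) : ℝ) : EReal) := hp
    rwa [smul_zero, add_zero, ← hr] at this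
  obtain ⟨φ, hφ0, hφ⟩ := exists_ne_zero_forall_nonneg_of_zero_notMem
    (hf.convex_epigraph.sub hray) ⟨_, hmem z r 1 hr.le one_pos⟩ h0
  let w := (InnerProductSpace.toDual ℝ (EuclideanSpace ℝ (Fin n))).symm
    (φ.comp (ContinuousLinearMap.inl ℝ (EuclideanSpace ℝ (Fin n)) ℝ))
  let l : ℝ := φ (0, 1)
  have hφ_eq : ∀ (y : EuclideanSpace ℝ (Fin n)) (s : ℝ), φ (y, s) = inner ℝ w y + s * l := by
    intro y s
    have h1 : inner ℝ w y = φ (y, 0) := by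
      simp [w, InnerProductSpace.toDual_symm_apply]
    have h2 : ((y, s) : EuclideanSpace ℝ (Fin n) × ℝ) = (y, 0) + s • (0, 1) := by
      ext1 <;> simp
    rw [h1, h2, map_add, map_smul, smul_eq_mul]
  have hineq : ∀ (y : EuclideanSpace ℝ (Fin n)) (s a : ℝ), f y ≤ s → 0 < a →
      0 ≤ inner ℝ w (y - z) - a * inner ℝ w v + (s - r) * l := fun y s a hy ha => by
    have := hφ _ (hmem y s a hy ha)
    rwa [hφ_eq, inner_sub_right, real_inner_smul_right] at this
  have hwv : inner ℝ w v ≤ 0 := by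
    have := hineq z r 1 hr.le one_pos
    simp only [sub_self, inner_zero_right] at this
    linarith
  have hl : 0 ≤ l := by
    by_contra! hl
    -- The height is chosen so that the inequality reads `0 ≤ -1`.
    have := hineq z (r + (1 - inner ℝ w v) / (-l)) 1
      (by rw [hr]; exact_mod_cast le_add_of_nonneg_right (by
        apply div_nonneg <;> linarith)) one_pos
    have h3 : (1 - inner ℝ w v) / (-l) * l = -(1 - inner ℝ w v) := by
      rw [div_neg, neg_mul, div_mul_cancel₀ _ hl.ne]
    simp only [sub_self, inner_zero_right, add_sub_cancel_left, h3] at this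
    linarith
  have hineq' : ∀ (y : EuclideanSpace ℝ (Fin n)) (s : ℝ), f y ≤ s →
      0 ≤ inner ℝ w (y - z) + (s - r) * l := fun y s hy => by
    refine le_of_forall_pos_le_add fun ε hε => ?_
    -- This is the limit `a → 0`; the added 1 keeps the denominator positive when `⟨w, v⟩ = 0`.
    have h1 := hineq y s (ε / (1 - inner ℝ w v)) hy (div_pos hε (by linarith))
    have h2 : -(ε / (1 - inner ℝ w v) * inner ℝ w v) ≤ ε := by
      have h3 : (1 - inner ℝ w v) ≠ 0 := by linarith
      have : ε - -(ε / (1 - inner ℝ w v) * inner ℝ w v) = ε / (1 - inner ℝ w v) := by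
        field_simp
        ring
      have h4 : 0 < ε / (1 - inner ℝ w v) := div_pos hε (by linarith)
      linarith
    linarith
  rcases hl.eq_or_lt with hl0 | hlpos
  -- Vertical hyperplane: `-w` is normal to the domain of `f` at `z`, so the subdifferential
  -- contains a whole ray, against boundedness.
  · obtain ⟨u, hu⟩ := hne
    have hw : w ≠ 0 := fun hw => hφ0 (by
      ext p
      · simpa [hw] using hφ_eq p 0
      · simpa [hw, ← hl0] using hφ_eq 0 1)
    have hline : ∀ t : ℝ, 0 ≤ t → u - t • w ∈ subdiff f z := fun t ht => by
      rw [mem_subdiff_iff hr] at hu ⊢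
      intro y s hy
      have h1 := hu y s hy
      have h2 := hineq' y s hy
      rw [← hl0, mul_zero, add_zero] at h2
      rw [inner_sub_left, real_inner_smul_left]
      nlinarith [mul_nonneg ht h2]
    obtain ⟨R, hR⟩ := hbd.exists_norm_le
    have hwpos : 0 < ‖w‖ := norm_pos_iff.2 hw
    have hR0 : 0 ≤ R := (norm_nonneg u).trans (hR u hu)
    have h1 := hR _ (hline ((R + ‖u‖ + 1) / ‖w‖) (by positivity))
    have h2 : ‖((R + ‖u‖ + 1) / ‖w‖) • w‖ = R + ‖u‖ + 1 := by
      rw [norm_smul, Real.norm_of_nonneg (by positivity)]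
      field_simp
    have h3 := norm_sub_norm_le (((R + ‖u‖ + 1) / ‖w‖) • w) u
    rw [norm_sub_rev] at h3
    linarith
  -- Non-vertical hyperplane: its slope is a subgradient with non-negative inner product with `v`.
  · have hmem' : -(l⁻¹ • w) ∈ subdiff f z := by
      rw [mem_subdiff_iff hr]
      intro y s hy
      have h2 := mul_nonneg (inv_pos.2 hlpos).le (hineq' y s hy)
      rw [mul_add, mul_comm (s - r), inv_mul_cancel_left₀ hlpos.ne'] at h2
      rw [inner_neg_left, real_inner_smul_left]
      linarith
    have := hv _ hmem'
    rw [inner_neg_left, real_inner_smul_left] at this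
    nlinarith [mul_nonneg (inv_pos.2 hlpos).le (neg_nonneg.2 hwv)]

/-- A relative interior point of the descent cone makes a negative inner product with every
subgradient, when the subdifferential is non-empty, compact and does not contain the origin. -/
theorem inner_neg_of_mem_intrinsicInterior_descentCone (hf : IsProperConvex f)
    (hcpt : IsCompact (subdiff f z)) (hzero : (0 : EuclideanSpace ℝ (Fin n)) ∉ subdiff f z)
    {u d : EuclideanSpace ℝ (Fin n)} (hu : u ∈ subdiff f z)
    (hd : d ∈ intrinsicInterior ℝ (descentCone f z)) : inner ℝ u d < 0 := by
  obtain ⟨φ, c, c', hφ, hc, hc'⟩ := geometric_hahn_banach_compact_closed hf.convex_subdiff hcpt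
    (convex_singleton (0 : EuclideanSpace ℝ (Fin n))) isClosed_singleton
    (disjoint_singleton_right.2 hzero)
  have hc0 : c < 0 := by
    have := hc' 0 rfl
    rw [map_zero] at this
    linarith
  let e := (InnerProductSpace.toDual ℝ (EuclideanSpace ℝ (Fin n))).symm φ
  have hneg : ∀ u ∈ subdiff f z, inner ℝ u e < 0 := fun u hu => by
    rw [real_inner_comm, InnerProductSpace.toDual_symm_apply]
    linarith [hφ u hu]
  have he := mem_descentCone_of_forall_inner_neg hf ⟨u, hu⟩ hcpt.isBounded hneg
  -- Prolonging the segment from `e` beyond `d` gives `(1 + ε)⟨u, d⟩ ≤ ε⟨u, e⟩ < 0`.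
  obtain ⟨ε, hε, hmem⟩ := exists_pos_add_smul_sub_mem_of_mem_intrinsicInterior hd he
  have h1 := inner_nonpos_of_mem_descentCone hf hu hmem
  rw [inner_add_right, real_inner_smul_right, inner_sub_right] at h1
  have h2 := mul_pos hε (neg_pos.2 (hneg u hu))
  by_contra! h3
  nlinarith [mul_nonneg hε.le h3]

end Subdifferential

/-! ### Support functions of bounded sets -/

section SupportFunction

variable {E : Type*} [NormedAddCommGroup E] [InnerProductSpace ℝ E] {S : Set E}

/-- The support function `w ↦ sup_{u ∈ S} ⟨w, u⟩`. -/
noncomputable def supportFun (S : Set E) (w : E) : ℝ :=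
  sSup ((fun u => inner ℝ w u) '' S)

theorem bddAbove_inner_image {R : ℝ} (hR : ∀ u ∈ S, ‖u‖ ≤ R) (w : E) :
    BddAbove ((fun u => inner ℝ w u) '' S) := by
  refine ⟨‖w‖ * R, ?_⟩
  rintro _ ⟨u, hu, rfl⟩
  exact (real_inner_le_norm w u).trans (mul_le_mul_of_nonneg_left (hR u hu) (norm_nonneg w))

theorem inner_le_supportFun {R : ℝ} (hR : ∀ u ∈ S, ‖u‖ ≤ R) (w : E) {u : E} (hu : u ∈ S) :
    inner ℝ w u ≤ supportFun S w :=
  le_csSup (bddAbove_inner_image hR w) (mem_image_of_mem _ hu)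

theorem supportFun_le (hne : S.Nonempty) {w : E} {c : ℝ} (h : ∀ u ∈ S, inner ℝ w u ≤ c) :
    supportFun S w ≤ c :=
  csSup_le (hne.image _) (forall_mem_image.2 h)

theorem supportFun_sub_le (hne : S.Nonempty) {R : ℝ} (hR : ∀ u ∈ S, ‖u‖ ≤ R) (w w' : E) :
    supportFun S w - supportFun S w' ≤ R * ‖w - w'‖ := by
  rw [sub_le_iff_le_add]
  refine supportFun_le hne fun u hu => ?_
  have h1 := inner_le_supportFun hR w' hu
  have h2 := (real_inner_le_norm (w - w') u).trans
    (mul_le_mul_of_nonneg_left (hR u hu) (norm_nonneg _))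
  rw [inner_sub_left] at h2
  linarith

theorem abs_supportFun_sub_le (hne : S.Nonempty) {R : ℝ} (hR : ∀ u ∈ S, ‖u‖ ≤ R) (w w' : E) :
    |supportFun S w - supportFun S w'| ≤ R * ‖w - w'‖ := by
  refine abs_sub_le_iff.2 ⟨supportFun_sub_le hne hR w w', ?_⟩
  rw [norm_sub_rev]
  exact supportFun_sub_le hne hR w' w

theorem exists_supportFun_eq_inner (hne : S.Nonempty) (hS : IsCompact S) (w : E) :
    ∃ u ∈ S, supportFun S w = inner ℝ w u :=
  hS.exists_sSup_image_eq hne (by fun_prop)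

end SupportFunction

/-! ### Projection residuals -/

section Residual

variable {E : Type*} [NormedAddCommGroup E] {K : Set E}

open Classical in
/-- The difference between a point and its projection to a set. -/
noncomputable def residual (K : Set E) (g : E) : E :=
  -- The default value 0 does not occur for non-empty compact `K`.
  if h : ∃ p ∈ K, Metric.infDist g K = dist g p then g - h.choose else 0

theorem sub_residual_mem (hK : IsCompact K) (hne : K.Nonempty) (g : E) :
    g - residual K g ∈ K := by
  have h := hK.exists_infDist_eq_dist hne g
  rw [residual, dif_pos h, sub_sub_cancel]
  exact h.choose_spec.1

theorem norm_residual (hK : IsCompact K) (hne : K.Nonempty) (g : E) :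
    ‖residual K g‖ = Metric.infDist g K := by
  have h := hK.exists_infDist_eq_dist hne g
  rw [residual, dif_pos h, ← dist_eq_norm]
  exact h.choose_spec.2.symm

theorem inner_residual_le [InnerProductSpace ℝ E] (hK : IsCompact K) (hconv : Convex ℝ K) (g : E) {s : E} (hs : s ∈ K) :
    inner ℝ (residual K g) s ≤ inner ℝ (residual K g) (g - residual K g) := by
  have hne : K.Nonempty := ⟨s, hs⟩
  have h := (norm_eq_iInf_iff_real_inner_le_zero hconv (u := g) (sub_residual_mem hK hne g)).1 (by
    rw [sub_sub_cancel, norm_residual hK hne, Metric.infDist_eq_iInf]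
    simp_rw [dist_eq_norm]) s hs
  rwa [sub_sub_cancel, inner_sub_right, sub_nonpos] at h

end Residual

/-! ### Weighted Minkowski sums -/

section WeightedSum

variable {E : Type*} [NormedAddCommGroup E] [InnerProductSpace ℝ E] {m : ℕ}
  {S : Fin m → Set E}

/-- The Minkowski sum `∑ i, τ i • S i`. -/
def weightedSum (S : Fin m → Set E) (τ : EuclideanSpace ℝ (Fin m)) : Set E :=
  ∑ i, τ i • S i

theorem mem_weightedSum {τ : EuclideanSpace ℝ (Fin m)} {s : E} :
    s ∈ weightedSum S τ ↔ ∃ u : Fin m → E, (∀ i, u i ∈ S i) ∧ ∑ i, τ i • u i = s := by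
  rw [weightedSum, mem_fintype_sum]
  constructor
  · rintro ⟨g, hg, rfl⟩
    choose u hu hgu using hg
    exact ⟨u, hu, Finset.sum_congr rfl fun i _ => hgu i⟩
  · rintro ⟨u, hu, rfl⟩
    exact ⟨fun i => τ i • u i, fun i => smul_mem_smul_set (hu i), rfl⟩

theorem weightedSum_nonempty (hne : ∀ i, (S i).Nonempty) (τ : EuclideanSpace ℝ (Fin m)) :
    (weightedSum S τ).Nonempty := by
  choose u hu using hne
  exact ⟨_, mem_weightedSum.2 ⟨u, hu, rfl⟩⟩

theorem isCompact_weightedSum (hS : ∀ i, IsCompact (S i)) (τ : EuclideanSpace ℝ (Fin m)) :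
    IsCompact (weightedSum S τ) := by
  have : weightedSum S τ = (fun u : Fin m → E => ∑ i, τ i • u i) '' univ.pi S := by
    ext s
    simp [mem_weightedSum]
  rw [this]
  exact (isCompact_univ_pi hS).image (by fun_prop)

theorem convex_weightedSum (hconv : ∀ i, Convex ℝ (S i)) (τ : EuclideanSpace ℝ (Fin m)) :
    Convex ℝ (weightedSum S τ) :=
  convex_sum _ fun i _ => (hconv i).smul (τ i)

theorem convex_orthant : Convex ℝ (orthant m) := by
  intro τ hτ σ hσ a b ha hb _ i
  exact add_nonneg (mul_nonneg ha (hτ i)) (mul_nonneg hb (hσ i))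

theorem zero_mem_orthant : (0 : EuclideanSpace ℝ (Fin m)) ∈ orthant m := fun _ => le_rfl

theorem isClosed_orthant : IsClosed (orthant m) := by
  simp only [orthant, ofPred_forall]
  exact isClosed_iInter fun i => isClosed_le continuous_const (by fun_prop)

/-- For convex `S i` and non-negative weights, `(p + q) • S i = p • S i + q • S i`. -/
theorem smul_add_smul_mem_weightedSum (hconv : ∀ i, Convex ℝ (S i))
    {τ σ : EuclideanSpace ℝ (Fin m)} (hτ : τ ∈ orthant m) (hσ : σ ∈ orthant m) {a b : ℝ}
    (ha : 0 ≤ a) (hb : 0 ≤ b) {s t : E} (hs : s ∈ weightedSum S τ) (ht : t ∈ weightedSum S σ) :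
    a • s + b • t ∈ weightedSum S (a • τ + b • σ) := by
  obtain ⟨u, hu, rfl⟩ := mem_weightedSum.1 hs
  obtain ⟨v, hv, rfl⟩ := mem_weightedSum.1 ht
  have key : ∀ i, ∃ y ∈ S i, (a * τ i + b * σ i) • y = a • τ i • u i + b • σ i • v i := by
    intro i
    have hi : a • τ i • u i + b • σ i • v i ∈ (a * τ i + b * σ i) • S i := by
      rw [(hconv i).add_smul (mul_nonneg ha (hτ i)) (mul_nonneg hb (hσ i)), smul_smul, smul_smul]
      exact add_mem_add (smul_mem_smul_set (hu i)) (smul_mem_smul_set (hv i))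
    exact hi
  choose y hy hyeq using key
  refine mem_weightedSum.2 ⟨y, hy, ?_⟩
  rw [Finset.smul_sum, Finset.smul_sum, ← Finset.sum_add_distrib]
  exact Finset.sum_congr rfl fun i _ => hyeq i

theorem inner_le_sum_mul_supportFun {R : ℝ} (hR : ∀ i, ∀ u ∈ S i, ‖u‖ ≤ R)
    {τ : EuclideanSpace ℝ (Fin m)} (hτ : τ ∈ orthant m) {s : E} (hs : s ∈ weightedSum S τ)
    (w : E) : inner ℝ w s ≤ ∑ i, τ i * supportFun (S i) w := by
  obtain ⟨u, hu, rfl⟩ := mem_weightedSum.1 hs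
  rw [inner_sum]
  refine Finset.sum_le_sum fun i _ => ?_
  rw [real_inner_smul_right]
  exact mul_le_mul_of_nonneg_left (inner_le_supportFun (hR i) w (hu i)) (hτ i)

/-- Maximizers on the individual `S i` combine into one point of the sum. With
`inner_le_sum_mul_supportFun`, this makes the support function of the sum linear in `τ` on the
orthant. -/
theorem sum_mul_supportFun_le (hne : ∀ i, (S i).Nonempty) (hS : ∀ i, IsCompact (S i))
    {τ : EuclideanSpace ℝ (Fin m)} {w : E} {c : ℝ} (h : ∀ s ∈ weightedSum S τ, inner ℝ w s ≤ c) :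
    ∑ i, τ i * supportFun (S i) w ≤ c := by
  choose u hu hueq using fun i => exists_supportFun_eq_inner (hne i) (hS i) w
  refine le_trans (le_of_eq ?_) (h _ (mem_weightedSum.2 ⟨u, hu, rfl⟩))
  rw [inner_sum]
  exact Finset.sum_congr rfl fun i _ => by rw [real_inner_smul_right, hueq]

end WeightedSum

/-! ### Dual formula for the squared distance -/

section Dual

variable {E : Type*} [NormedAddCommGroup E] [InnerProductSpace ℝ E] {m : ℕ}
  {S : Fin m → Set E}

/-- The concave dual objective of the squared distance to `∑ i, τ i • S i`. -/
noncomputable def dualObj (S : Fin m → Set E) (g : E) (τ : EuclideanSpace ℝ (Fin m)) (w : E) : ℝ :=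
  2 * inner ℝ w g - ‖w‖ ^ 2 - 2 * ∑ i, τ i * supportFun (S i) w

/-- The gradient in `τ` of the squared distance from `g` to `∑ i, τ i • S i`. -/
noncomputable def distGrad (S : Fin m → Set E) (g : E) (τ : EuclideanSpace ℝ (Fin m)) :
    EuclideanSpace ℝ (Fin m) :=
  WithLp.toLp 2 fun i => -2 * supportFun (S i) (residual (weightedSum S τ) g)

theorem inner_distGrad (g : E) (τ v : EuclideanSpace ℝ (Fin m)) :
    inner ℝ (distGrad S g τ) v =
      -2 * ∑ i, v i * supportFun (S i) (residual (weightedSum S τ) g) := by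
  rw [PiLp.inner_apply, Finset.mul_sum]
  refine Finset.sum_congr rfl fun i _ => ?_
  simp only [distGrad, RCLike.inner_apply, conj_trivial]
  ring

/-- All the members of the family are non-empty, compact and convex. -/
structure IsNonemptyCompactConvexFamily (S : Fin m → Set E) : Prop where
  nonempty : ∀ i, (S i).Nonempty
  isCompact : ∀ i, IsCompact (S i)
  convex : ∀ i, Convex ℝ (S i)

namespace IsNonemptyCompactConvexFamily

variable (h : IsNonemptyCompactConvexFamily S)
include h

theorem exists_norm_le : ∃ R : ℝ, 0 ≤ R ∧ ∀ i, ∀ u ∈ S i, ‖u‖ ≤ R := by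
  have : Bornology.IsBounded (⋃ i, S i) :=
    Bornology.isBounded_iUnion.2 fun i => (h.isCompact i).isBounded
  obtain ⟨R, hR0, hR⟩ := this.exists_pos_norm_le
  exact ⟨R, hR0.le, fun i u hu => hR u (mem_iUnion.2 ⟨i, hu⟩)⟩

theorem norm_residual (g : E) (τ : EuclideanSpace ℝ (Fin m)) :
    ‖residual (weightedSum S τ) g‖ = Metric.infDist g (weightedSum S τ) :=
  PriorCone.norm_residual (isCompact_weightedSum h.isCompact τ) (weightedSum_nonempty h.nonempty τ) g

/-- The projection of `g` bounds the support function at `w` from below; completing the square then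
leaves the deficit `‖residual - w‖²`, which drives the Lipschitz estimate. -/
theorem dualObj_le (g : E) {τ : EuclideanSpace ℝ (Fin m)} (hτ : τ ∈ orthant m) (w : E) :
    dualObj S g τ w ≤ Metric.infDist g (weightedSum S τ) ^ 2
      - ‖residual (weightedSum S τ) g - w‖ ^ 2 := by
  obtain ⟨R, -, hR⟩ := h.exists_norm_le
  have hmem := sub_residual_mem (isCompact_weightedSum h.isCompact τ)
    (weightedSum_nonempty h.nonempty τ) g
  have h1 := inner_le_sum_mul_supportFun hR hτ hmem w
  rw [← h.norm_residual, norm_sub_sq_real, real_inner_comm, dualObj]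
  rw [inner_sub_right] at h1
  linarith

/-- The variational inequality says that the projection maximizes the inner product with the
residual, so duality is tight there. -/
theorem dualObj_residual (g : E) {τ : EuclideanSpace ℝ (Fin m)} (hτ : τ ∈ orthant m) :
    dualObj S g τ (residual (weightedSum S τ) g) = Metric.infDist g (weightedSum S τ) ^ 2 := by
  refine le_antisymm ((h.dualObj_le g hτ _).trans (by simp)) ?_
  have h1 := sum_mul_supportFun_le h.nonempty h.isCompact fun s hs => inner_residual_le
    (isCompact_weightedSum h.isCompact τ) (convex_weightedSum h.convex τ) g hs
  rw [inner_sub_right, real_inner_self_eq_norm_sq] at h1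
  rw [← h.norm_residual, dualObj]
  linarith

/-- The optimal `w` for `τ` remains a lower bound at `σ`, and the dual objective is affine in the
weights. -/
theorem inner_distGrad_le (g : E) {τ σ : EuclideanSpace ℝ (Fin m)} (hτ : τ ∈ orthant m)
    (hσ : σ ∈ orthant m) :
    inner ℝ (distGrad S g τ) (σ - τ) ≤
      Metric.infDist g (weightedSum S σ) ^ 2 - Metric.infDist g (weightedSum S τ) ^ 2 := by
  have h1 := h.dualObj_le g hσ (residual (weightedSum S τ) g)
  rw [← h.dualObj_residual g hτ, inner_distGrad]
  simp only [dualObj, PiLp.sub_apply, sub_mul, Finset.sum_sub_distrib] at h1 ⊢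
  nlinarith [sq_nonneg ‖residual (weightedSum S σ) g - residual (weightedSum S τ) g‖]

/-- The residual depends on the point and on the weights in a Lipschitz way. -/
theorem norm_residual_sub_residual_le {R : ℝ} (hR : ∀ i, ∀ u ∈ S i, ‖u‖ ≤ R) (g g' : E)
    {τ σ : EuclideanSpace ℝ (Fin m)} (hτ : τ ∈ orthant m) (hσ : σ ∈ orthant m) :
    ‖residual (weightedSum S τ) g - residual (weightedSum S σ) g'‖ ≤
      ‖g - g'‖ + R * ∑ i, |τ i - σ i| := by
  -- Each dual problem is tested at the other's optimum. The two deficits add up to `2‖w - w'‖²`,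
  -- bounded by terms linear in `‖w - w'‖`.
  have h1 := h.dualObj_le g hτ (residual (weightedSum S σ) g')
  have h2 := h.dualObj_le g' hσ (residual (weightedSum S τ) g)
  rw [← h.dualObj_residual g hτ] at h1
  rw [← h.dualObj_residual g' hσ, norm_sub_rev] at h2
  set w := residual (weightedSum S τ) g
  set w' := residual (weightedSum S σ) g'
  have h3 : -∑ i, (τ i - σ i) * (supportFun (S i) w - supportFun (S i) w') ≤
      (R * ∑ i, |τ i - σ i|) * ‖w - w'‖ := by
    rw [← Finset.sum_neg_distrib, Finset.mul_sum, Finset.sum_mul]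
    refine Finset.sum_le_sum fun i _ => (neg_le_abs _).trans ?_
    rw [abs_mul, mul_comm R, mul_assoc]
    exact mul_le_mul_of_nonneg_left (abs_supportFun_sub_le (h.nonempty i) (hR i) w w')
      (abs_nonneg _)
  have h4 := real_inner_le_norm (w - w') (g - g')
  simp only [inner_sub_left, inner_sub_right] at h4
  simp only [mul_sub, sub_mul, Finset.sum_sub_distrib] at h3
  simp only [dualObj] at h1 h2
  rcases (norm_nonneg (w - w')).eq_or_lt with h0 | hpos
  · rw [← h0]
    have hR0 : 0 ≤ R * ∑ i, |τ i - σ i| := by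
      rw [Finset.mul_sum]
      refine Finset.sum_nonneg fun i _ => mul_nonneg ?_ (abs_nonneg _)
      obtain ⟨u, hu⟩ := h.nonempty i
      exact (norm_nonneg u).trans (hR i u hu)
    positivity
  · refine le_of_mul_le_mul_right ?_ hpos
    linarith

theorem norm_distGrad_sub_le {R : ℝ} (hR : ∀ i, ∀ u ∈ S i, ‖u‖ ≤ R) (g g' : E)
    {τ σ : EuclideanSpace ℝ (Fin m)} (hτ : τ ∈ orthant m) (hσ : σ ∈ orthant m) (i : Fin m) :
    |distGrad S g τ i - distGrad S g' σ i| ≤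
      2 * R * (‖g - g'‖ + R * ∑ i, |τ i - σ i|) := by
  have hR0 : 0 ≤ R := by
    obtain ⟨u, hu⟩ := h.nonempty i
    exact (norm_nonneg u).trans (hR i u hu)
  have h1 := abs_supportFun_sub_le (h.nonempty i) (hR i) (residual (weightedSum S τ) g)
    (residual (weightedSum S σ) g')
  have h2 := mul_le_mul_of_nonneg_left (h.norm_residual_sub_residual_le hR g g' hτ hσ) hR0
  simp only [distGrad, ← mul_sub, abs_mul, abs_neg, Nat.abs_ofNat]
  linarith

end IsNonemptyCompactConvexFamily

end Dual

/-! ### From subgradients to gradients -/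

section Subgradient

variable {F : Type*} [NormedAddCommGroup F] [InnerProductSpace ℝ F]

/-- A function with a subgradient at each point of a convex set is convex there. -/
theorem convexOn_of_forall_inner_le {s : Set F} (hs : Convex ℝ s) {φ : F → ℝ} {G : F → F}
    (h : ∀ x ∈ s, ∀ y ∈ s, inner ℝ (G x) (y - x) ≤ φ y - φ x) : ConvexOn ℝ s φ := by
  refine ⟨hs, fun x hx y hy a b ha hb hab => ?_⟩
  have hz := hs hx hy ha hb hab
  have h1 := mul_le_mul_of_nonneg_left (h _ hz x hx) ha
  have h2 := mul_le_mul_of_nonneg_left (h _ hz y hy) hb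
  have h3 : a * inner ℝ (G (a • x + b • y)) (x - (a • x + b • y)) +
      b * inner ℝ (G (a • x + b • y)) (y - (a • x + b • y)) = 0 := by
    rw [← real_inner_smul_right, ← real_inner_smul_right, ← inner_add_right]
    obtain rfl : b = 1 - a := by linarith
    convert inner_zero_right (𝕜 := ℝ) (G (a • x + (1 - a) • y)) using 2
    module
  have h4 : φ (a • x + b • y) = a * φ (a • x + b • y) + b * φ (a • x + b • y) := by
    rw [← add_mul, hab, one_mul]
  simp only [smul_eq_mul]
  linarith

/-- A continuous selection of subgradients is the gradient. -/
theorem hasGradientWithinAt_of_forall_inner_le [CompleteSpace F] {s : Set F} {φ : F → ℝ} {G : F → F}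
    (hG : ContinuousOn G s)
    (h : ∀ x ∈ s, ∀ y ∈ s, inner ℝ (G x) (y - x) ≤ φ y - φ x) {x : F} (hx : x ∈ s) :
    HasGradientWithinAt φ (G x) s x := by
  rw [hasGradientWithinAt_iff_isLittleO, Asymptotics.isLittleO_iff]
  intro c hc
  filter_upwards [Metric.continuousWithinAt_iff'.1 (hG x hx) c hc, self_mem_nhdsWithin]
    with y hy hys
  -- Subgradients at both ends give `0 ≤ φ y - φ x - ⟨G x, y - x⟩ ≤ ⟨G y - G x, y - x⟩`.
  have h1 := h x hx y hys
  have h2 := h y hys x hx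
  have h3 := (real_inner_le_norm (G y - G x) (y - x)).trans
    (mul_le_mul_of_nonneg_right (dist_eq_norm (G y) (G x) ▸ hy.le) (norm_nonneg _))
  rw [inner_sub_left] at h3
  rw [← neg_sub y x, inner_neg_right] at h2
  rw [Real.norm_eq_abs, abs_of_nonneg (by linarith)]
  linarith

end Subgradient

/-- The line through `τ` along the i-th axis stays in the orthant for parameters in `Ici (-τ i)`: a
neighbourhood of 0 if `τ i > 0`, and `Ici 0` if `τ i = 0`. -/
theorem hasOrthantPartial_of_hasGradientWithinAt {m : ℕ} {φ : EuclideanSpace ℝ (Fin m) → ℝ}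
    {τ v : EuclideanSpace ℝ (Fin m)} (hτ : τ ∈ orthant m)
    (h : HasGradientWithinAt φ v (orthant m) τ) (i : Fin m) : HasOrthantPartial φ i (v i) τ := by
  have key : HasDerivWithinAt
      (fun s : ℝ => φ (τ + s • EuclideanSpace.single i (1 : ℝ))) (v i) (Ici (-τ i)) 0 := by
    have hline : HasDerivWithinAt (fun s : ℝ => τ + s • EuclideanSpace.single i (1 : ℝ))
        (EuclideanSpace.single i (1 : ℝ)) (Ici (-τ i)) 0 := by
      simpa using (((hasDerivAt_id (0 : ℝ)).smul_const
        (EuclideanSpace.single i (1 : ℝ))).const_add τ).hasDerivWithinAt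
    have hmaps : MapsTo (fun s : ℝ => τ + s • EuclideanSpace.single i (1 : ℝ)) (Ici (-τ i))
        (orthant m) := by
      intro s hs j
      rcases eq_or_ne j i with rfl | hj
      · have : -τ j ≤ s := hs
        simp
        linarith
      · simpa [hj] using hτ j
    have h' : HasFDerivWithinAt φ ((InnerProductSpace.toDual ℝ _) v) (orthant m)
        (τ + (0 : ℝ) • EuclideanSpace.single i (1 : ℝ)) := by
      rw [zero_smul, add_zero]
      exact h.hasFDerivWithinAt
    have := h'.comp_hasDerivWithinAt (0 : ℝ) hline hmaps
    simpa [Function.comp_def, InnerProductSpace.toDual_apply_apply,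
      EuclideanSpace.inner_single_right] using this
  refine ⟨fun hpos => key.hasDerivAt (Ici_mem_nhds (by linarith)), fun h0 => ?_⟩
  rwa [h0, neg_zero] at key

/-! ### Full support and second moments -/

section SecondMoment

instance isOpenPosMeasure_stdGaussian {n : ℕ} :
    (stdGaussian (EuclideanSpace ℝ (Fin n))).IsOpenPosMeasure := by
  have : (gaussianReal 0 1).IsOpenPosMeasure :=
    (gaussianReal_absolutelyContinuous' 0 one_ne_zero).isOpenPosMeasure
  rw [← map_pi_eq_stdGaussian]
  exact Continuous.isOpenPosMeasure_map (by fun_prop) (WithLp.toLp_surjective 2)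

variable {E : Type*} [NormedAddCommGroup E] [MeasurableSpace E] [BorelSpace E] {μ : Measure E}
  [IsFiniteMeasure μ]

/-- Lipschitz functions grow at most linearly; this is the source of all the integrability used. -/
theorem memLp_of_abs_sub_le (hμ : MemLp id 2 μ) {φ : E → ℝ} {C : ℝ}
    (hφ : ∀ g g', |φ g - φ g'| ≤ C * ‖g - g'‖) : MemLp φ 2 μ := by
  have hcont : Continuous φ := by
    refine (LipschitzWith.of_dist_le_mul (K := C.toNNReal) fun g g' => ?_).continuous
    rw [Real.dist_eq, dist_eq_norm]
    exact (hφ g g').trans (mul_le_mul_of_nonneg_right (Real.le_coe_toNNReal C) (norm_nonneg _))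
  refine ((hμ.norm.const_mul C).add (memLp_const |φ 0|)).of_le
    hcont.measurable.aestronglyMeasurable (ae_of_all _ fun g => ?_)
  have h1 := hφ g 0
  rw [sub_zero] at h1
  have h2 := abs_sub_abs_le_abs_sub (φ g) (φ 0)
  simp only [Real.norm_eq_abs, Pi.add_apply, id]
  exact (by linarith : |φ g| ≤ C * ‖g‖ + |φ 0|).trans (le_abs_self _)

theorem memLp_infDist (hμ : MemLp id 2 μ) (K : Set E) :
    MemLp (fun g => Metric.infDist g K) 2 μ :=
  memLp_of_abs_sub_le (C := 1) hμ fun g g' => by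
    rw [← Real.dist_eq, one_mul, ← dist_eq_norm]
    simpa using (Metric.lipschitz_infDist_pt K).dist_le_mul g g'

end SecondMoment

/-! ### The expected squared distance -/

section ExpectedDistance

variable {E : Type*} [NormedAddCommGroup E] [InnerProductSpace ℝ E] [MeasurableSpace E]
  [BorelSpace E] {μ : Measure E} [IsProbabilityMeasure μ] {m : ℕ} {S : Fin m → Set E}

/-- The expected squared distance to `∑ i, τ i • S i`. -/
noncomputable def expSqDist (μ : Measure E) (S : Fin m → Set E)
    (τ : EuclideanSpace ℝ (Fin m)) : ℝ :=
  ∫ g, Metric.infDist g (weightedSum S τ) ^ 2 ∂μ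

/-- The expectation of the gradient of the squared distance. -/
noncomputable def expDistGrad (μ : Measure E) (S : Fin m → Set E)
    (τ : EuclideanSpace ℝ (Fin m)) : EuclideanSpace ℝ (Fin m) :=
  WithLp.toLp 2 fun i => ∫ g, distGrad S g τ i ∂μ

namespace IsNonemptyCompactConvexFamily

variable (h : IsNonemptyCompactConvexFamily S) (hμ : MemLp id 2 μ)
include h hμ

theorem integrable_distGrad {τ : EuclideanSpace ℝ (Fin m)} (hτ : τ ∈ orthant m) (i : Fin m) :
    Integrable (fun g => distGrad S g τ i) μ := by
  obtain ⟨R, -, hR⟩ := h.exists_norm_le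
  refine (memLp_of_abs_sub_le (C := 2 * R) hμ fun g g' => ?_).integrable one_le_two
  simpa using h.norm_distGrad_sub_le hR g g' hτ hτ i

theorem inner_expDistGrad_le {τ σ : EuclideanSpace ℝ (Fin m)} (hτ : τ ∈ orthant m)
    (hσ : σ ∈ orthant m) :
    inner ℝ (expDistGrad μ S τ) (σ - τ) ≤ expSqDist μ S σ - expSqDist μ S τ := by
  have hint : ∀ i ∈ Finset.univ, Integrable (fun g => distGrad S g τ i * (σ - τ) i) μ :=
    fun i _ => (h.integrable_distGrad hμ hτ i).mul_const _
  have h1 : inner ℝ (expDistGrad μ S τ) (σ - τ) = ∫ g, inner ℝ (distGrad S g τ) (σ - τ) ∂μ := by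
    simp only [PiLp.inner_apply, RCLike.inner_apply', conj_trivial]
    rw [integral_finsetSum _ hint]
    exact Finset.sum_congr rfl fun i _ => (integral_mul_const _ _).symm
  rw [h1, expSqDist, expSqDist,
    ← integral_sub (memLp_infDist hμ _).integrable_sq (memLp_infDist hμ _).integrable_sq]
  refine integral_mono ?_ ((memLp_infDist hμ _).integrable_sq.sub
    (memLp_infDist hμ _).integrable_sq) fun g => h.inner_distGrad_le g hτ hσ
  simpa only [PiLp.inner_apply, RCLike.inner_apply', conj_trivial] using
    integrable_finsetSum _ hint

/-- The Lipschitz bound in the weights does not depend on `g`, so it survives integration. -/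
theorem continuousOn_expDistGrad : ContinuousOn (expDistGrad μ S) (orthant m) := by
  obtain ⟨R, -, hR⟩ := h.exists_norm_le
  refine (PiLp.continuous_toLp 2 _).comp_continuousOn (continuousOn_pi.2 fun i τ hτ => ?_)
  have hbound : ∀ σ ∈ orthant m, dist (∫ g, distGrad S g σ i ∂μ) (∫ g, distGrad S g τ i ∂μ) ≤
      2 * R * (R * ∑ j, |σ j - τ j|) := by
    intro σ hσ
    rw [dist_eq_norm, ← integral_sub (h.integrable_distGrad hμ hσ i)
      (h.integrable_distGrad hμ hτ i)]
    refine (norm_integral_le_of_norm_le_const (ae_of_all _ fun g => ?_)).trans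
      (by rw [probReal_univ, mul_one])
    simpa using h.norm_distGrad_sub_le hR g g hσ hτ i
  refine tendsto_iff_dist_tendsto_zero.2 (squeeze_zero' (Filter.Eventually.of_forall fun _ =>
    dist_nonneg) (eventually_nhdsWithin_of_forall hbound) ?_)
  have : Continuous fun σ : EuclideanSpace ℝ (Fin m) => 2 * R * (R * ∑ j, |σ j - τ j|) := by
    fun_prop
  simpa using (this.tendsto τ).mono_left nhdsWithin_le_nhds

theorem convexOn_expSqDist : ConvexOn ℝ (orthant m) (expSqDist μ S) :=
  convexOn_of_forall_inner_le convex_orthant fun _ hτ _ hσ => h.inner_expDistGrad_le hμ hτ hσ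

theorem hasGradientWithinAt_expSqDist {τ : EuclideanSpace ℝ (Fin m)} (hτ : τ ∈ orthant m) :
    HasGradientWithinAt (expSqDist μ S) (expDistGrad μ S τ) (orthant m) τ :=
  hasGradientWithinAt_of_forall_inner_le (h.continuousOn_expDistGrad hμ)
    (fun _ hτ _ hσ => h.inner_expDistGrad_le hμ hτ hσ) hτ

theorem continuousOn_expSqDist : ContinuousOn (expSqDist μ S) (orthant m) :=
  fun _ hτ => (h.hasGradientWithinAt_expSqDist hμ hτ).continuousWithinAt

theorem isC1OnOrthant_expSqDist : IsC1OnOrthant (expSqDist μ S) :=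
  ⟨expDistGrad μ S, h.continuousOn_expDistGrad hμ, fun _ hτ =>
    ⟨h.hasGradientWithinAt_expSqDist hμ hτ, fun i =>
      hasOrthantPartial_of_hasGradientWithinAt hτ (h.hasGradientWithinAt_expSqDist hμ hτ) i⟩⟩

omit hμ [MeasurableSpace E] [BorelSpace E] in
theorem convexOn_sq_infDist (g : E) :
    ConvexOn ℝ (orthant m) fun τ => Metric.infDist g (weightedSum S τ) ^ 2 :=
  convexOn_of_forall_inner_le convex_orthant fun _ hτ _ hσ => h.inner_distGrad_le g hτ hσ

omit hμ [MeasurableSpace E] [BorelSpace E] in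
-- Mixing `g` with its projection `p` to the second set gives a point of the mixed sum at distance
-- `b * dist g p`; strictness is `b ^ 2 < b`.
theorem sq_infDist_lt_of_mem_of_notMem {τ σ : EuclideanSpace ℝ (Fin m)} (hτ : τ ∈ orthant m)
    (hσ : σ ∈ orthant m) {a b : ℝ} (ha : 0 < a) (hb : 0 < b) (hab : a + b = 1) {g : E}
    (hgτ : g ∈ weightedSum S τ) (hgσ : g ∉ weightedSum S σ) :
    Metric.infDist g (weightedSum S (a • τ + b • σ)) ^ 2 <
      a * Metric.infDist g (weightedSum S τ) ^ 2 + b * Metric.infDist g (weightedSum S σ) ^ 2 := by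
  have hcσ := isCompact_weightedSum h.isCompact σ
  have hneσ := weightedSum_nonempty h.nonempty σ
  have hpos : 0 < Metric.infDist g (weightedSum S σ) :=
    (hcσ.isClosed.notMem_iff_infDist_pos hneσ).1 hgσ
  obtain ⟨p, hp, hpd⟩ := hcσ.exists_infDist_eq_dist hneσ g
  have h1 : Metric.infDist g (weightedSum S (a • τ + b • σ)) ≤
      b * Metric.infDist g (weightedSum S σ) := by
    refine (Metric.infDist_le_dist_of_mem
      (smul_add_smul_mem_weightedSum h.convex hτ hσ ha.le hb.le hgτ hp)).trans (le_of_eq ?_)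
    have : g - (a • g + b • p) = b • (g - p) := by
      obtain rfl : a = 1 - b := by linarith
      module
    rw [dist_eq_norm, this, norm_smul, Real.norm_of_nonneg hb.le, hpd, dist_eq_norm]
  rw [Metric.infDist_zero_of_mem hgτ]
  have h2 := pow_le_pow_left₀ Metric.infDist_nonneg h1 2
  have h3 : b * b < b * 1 := mul_lt_mul_of_pos_left (by linarith) hb
  have h4 := mul_lt_mul_of_pos_right h3 (pow_pos hpos 2)
  nlinarith

/-- The convexity gap is continuous and non-negative in `g`, and positive at a point lying in only
one of the two sums; a measure of full support integrates it to a positive number. -/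
theorem strictConvexOn_expSqDist [μ.IsOpenPosMeasure]
    (hinj : ∀ τ ∈ orthant m, ∀ σ ∈ orthant m, τ ≠ σ → weightedSum S τ ≠ weightedSum S σ) :
    StrictConvexOn ℝ (orthant m) (expSqDist μ S) := by
  refine ⟨convex_orthant, fun τ hτ σ hσ hne a b ha hb hab => ?_⟩
  have hint := fun ρ => (memLp_infDist hμ (weightedSum S ρ)).integrable_sq
  obtain ⟨g, hg⟩ : ∃ g, Metric.infDist g (weightedSum S (a • τ + b • σ)) ^ 2 <
      a * Metric.infDist g (weightedSum S τ) ^ 2 +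
        b * Metric.infDist g (weightedSum S σ) ^ 2 := by
    by_cases hsub : weightedSum S τ ⊆ weightedSum S σ
    · obtain ⟨g, hgσ, hgτ⟩ := not_subset.1 fun hsub' =>
        hinj τ hτ σ hσ hne (hsub.antisymm hsub')
      refine ⟨g, ?_⟩
      rw [add_comm (a • τ), add_comm (a * _)]
      exact h.sq_infDist_lt_of_mem_of_notMem hσ hτ hb ha (by linarith) hgσ hgτ
    · obtain ⟨g, hgτ, hgσ⟩ := not_subset.1 hsub
      exact ⟨g, h.sq_infDist_lt_of_mem_of_notMem hτ hσ ha hb hab hgτ hgσ⟩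
  have hpos : 0 < ∫ g, (a * Metric.infDist g (weightedSum S τ) ^ 2 +
      b * Metric.infDist g (weightedSum S σ) ^ 2 -
        Metric.infDist g (weightedSum S (a • τ + b • σ)) ^ 2) ∂μ := by
    refine integral_pos_of_integrable_nonneg_nonzero (x := g) ?_
      ((((hint τ).const_mul a).add ((hint σ).const_mul b)).sub (hint _)) (fun g => ?_)
      (by linarith)
    · have hc : ∀ ρ, Continuous fun g => Metric.infDist g (weightedSum S ρ) :=
        fun ρ => Metric.continuous_infDist_pt _
      exact (((hc τ).pow 2).const_mul a |>.add (((hc σ).pow 2).const_mul b)).sub ((hc _).pow 2)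
    · exact sub_nonneg.2 ((h.convexOn_sq_infDist g).2 hτ hσ ha.le hb.le hab)
  have hadd : Integrable (fun g => a * Metric.infDist g (weightedSum S τ) ^ 2 +
      b * Metric.infDist g (weightedSum S σ) ^ 2) μ :=
    ((hint τ).const_mul a).add ((hint σ).const_mul b)
  rw [integral_sub hadd (hint _),
    integral_add ((hint τ).const_mul a) ((hint σ).const_mul b), integral_const_mul,
    integral_const_mul] at hpos
  exact sub_pos.1 hpos

/-- Coercivity, when some direction makes a uniformly negative inner product with all the sets. -/
theorem norm_sq_le_of_forall_inner_le {d : E} {c : ℝ}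
    (hd : ∀ i, ∀ u ∈ S i, inner ℝ u d ≤ -c) (hc : 0 ≤ c)
    {τ : EuclideanSpace ℝ (Fin m)} (hτ : τ ∈ orthant m) :
    c ^ 2 * ‖τ‖ ^ 2 ≤ 2 * ‖d‖ ^ 2 * (∫ g, ‖g‖ ^ 2 ∂μ + expSqDist μ S τ) := by
  have hint := (memLp_infDist hμ (weightedSum S τ)).integrable_sq
  have hint' : Integrable (fun g : E => ‖g‖ ^ 2) μ := hμ.norm.integrable_sq
  have hsum : 0 ≤ ∑ i, τ i := Finset.sum_nonneg fun i _ => hτ i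
  have hnorm : ‖τ‖ ^ 2 ≤ (∑ i, τ i) ^ 2 := by
    rw [EuclideanSpace.norm_sq_eq]
    simp only [Real.norm_eq_abs, sq_abs]
    exact Finset.sum_sq_le_sq_sum_of_nonneg fun i _ => hτ i
  have hpt : ∀ g : E, c ^ 2 * ‖τ‖ ^ 2 ≤
      2 * ‖d‖ ^ 2 * (‖g‖ ^ 2 + Metric.infDist g (weightedSum S τ) ^ 2) := by
    intro g
    rw [← h.norm_residual]
    have hmem := sub_residual_mem (isCompact_weightedSum h.isCompact τ)
      (weightedSum_nonempty h.nonempty τ) g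
    set w := residual (weightedSum S τ) g
    obtain ⟨u, hu, hug⟩ := mem_weightedSum.1 hmem
    -- The projection `g - w` is a weighted sum of points of the `S i`, so its inner product with
    -- `d` controls `∑ i, τ i`. The factor 2 in the claim comes from `(a + b)² ≤ 2(a² + b²)`.
    have h1 : c * ∑ i, τ i ≤ -inner ℝ (g - w) d := by
      rw [← hug, sum_inner, ← Finset.sum_neg_distrib, Finset.mul_sum]
      refine Finset.sum_le_sum fun i _ => ?_
      rw [real_inner_smul_left]
      nlinarith [mul_le_mul_of_nonneg_left (hd i (u i) (hu i)) (hτ i)]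
    have h2 : c * ∑ i, τ i ≤ (‖g‖ + ‖w‖) * ‖d‖ :=
      h1.trans ((neg_le_abs _).trans ((abs_real_inner_le_norm _ _).trans
        (mul_le_mul_of_nonneg_right (norm_sub_le g w) (norm_nonneg d))))
    have h3 := pow_le_pow_left₀ (mul_nonneg hc hsum) h2 2
    have h4 := mul_le_mul_of_nonneg_left hnorm (sq_nonneg c)
    have h5 := mul_le_mul_of_nonneg_right (add_sq_le (a := ‖g‖) (b := ‖w‖)) (sq_nonneg ‖d‖)
    rw [mul_pow, mul_pow] at h3
    linarith
  have := integral_mono (integrable_const (c ^ 2 * ‖τ‖ ^ 2))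
    ((hint'.add hint).const_mul (2 * ‖d‖ ^ 2)) hpt
  rwa [integral_const, probReal_univ, one_smul, integral_const_mul,
    integral_add' hint' hint] at this

theorem exists_isCompact_isMinOn {d : E} {c : ℝ} (hc : 0 < c)
    (hd : ∀ i, ∀ u ∈ S i, inner ℝ u d ≤ -c) :
    ∃ K : Set (EuclideanSpace ℝ (Fin m)), IsCompact K ∧ K ⊆ orthant m ∧
      (∃ τ ∈ K, IsMinOn (expSqDist μ S) (orthant m) τ) ∧
      ∀ τ ∈ orthant m, IsMinOn (expSqDist μ S) (orthant m) τ → τ ∈ K := by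
  -- Coercivity confines the sublevel set of the value at `τ = 0` to this radius; every minimizer
  -- lies in that sublevel set.
  set ρ : ℝ := √(2 * ‖d‖ ^ 2 * (∫ g, ‖g‖ ^ 2 ∂μ + expSqDist μ S 0) / c ^ 2)
  have hsub : ∀ τ ∈ orthant m, expSqDist μ S τ ≤ expSqDist μ S 0 →
      τ ∈ orthant m ∩ Metric.closedBall 0 ρ := fun τ hτ hle => by
    refine ⟨hτ, mem_closedBall_zero_iff.2 (Real.le_sqrt_of_sq_le ?_)⟩
    rw [le_div_iff₀ (by positivity), mul_comm]
    refine (h.norm_sq_le_of_forall_inner_le hμ hd hc.le hτ).trans ?_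
    gcongr
  have hK : IsCompact (orthant m ∩ Metric.closedBall 0 ρ) :=
    (isCompact_closedBall 0 ρ).inter_left isClosed_orthant
  obtain ⟨τ₀, hτ₀, hmin⟩ := hK.exists_isMinOn ⟨0, hsub 0 zero_mem_orthant le_rfl⟩
    ((h.continuousOn_expSqDist hμ).mono inter_subset_left)
  refine ⟨_, hK, inter_subset_left, ⟨τ₀, hτ₀, fun τ hτ => ?_⟩,
    fun τ hτ hτmin => hsub τ hτ (hτmin zero_mem_orthant)⟩
  rcases le_total (expSqDist μ S τ) (expSqDist μ S 0) with hle | hle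
  · exact hmin (hsub τ hτ hle)
  · exact (hmin (hsub 0 zero_mem_orthant le_rfl)).trans hle

end IsNonemptyCompactConvexFamily

end ExpectedDistance

/-! ### Polarity bound and the common descent direction -/

section StatisticalDimension

variable {n k : ℕ} {f : Fin (k + 1) → EuclideanSpace ℝ (Fin n) → EReal}
  {x : EuclideanSpace ℝ (Fin n)}

theorem zero_mem_priorRestrictedCone : (0 : EuclideanSpace ℝ (Fin n)) ∈ priorRestrictedCone f x :=
  ⟨1, one_pos, fun i => by simp⟩

theorem nonempty_inter_closedBall {K : Set (EuclideanSpace ℝ (Fin n))} (h0 : 0 ∈ K) :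
    (K ∩ Metric.closedBall 0 1).Nonempty :=
  ⟨0, h0, Metric.mem_closedBall_self zero_le_one⟩

theorem norm_le_one_of_mem_inter_closedBall {K : Set (EuclideanSpace ℝ (Fin n))} :
    ∀ u ∈ K ∩ Metric.closedBall 0 1, ‖u‖ ≤ 1 :=
  fun _ hu => mem_closedBall_zero_iff.1 hu.2

theorem supInnerBall_eq_supportFun (K : Set (EuclideanSpace ℝ (Fin n))) :
    supInnerBall K = supportFun (K ∩ Metric.closedBall 0 1) := rfl

theorem memLp_supInnerBall {K : Set (EuclideanSpace ℝ (Fin n))} (h0 : 0 ∈ K) :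
    MemLp (supInnerBall K) 2 (stdGaussian (EuclideanSpace ℝ (Fin n))) := by
  rw [supInnerBall_eq_supportFun]
  exact memLp_of_abs_sub_le IsGaussian.memLp_two_id fun g g' =>
    abs_supportFun_sub_le (nonempty_inter_closedBall h0) norm_le_one_of_mem_inter_closedBall g g'

theorem supInnerBall_nonneg {K : Set (EuclideanSpace ℝ (Fin n))} (h0 : 0 ∈ K)
    (g : EuclideanSpace ℝ (Fin n)) : 0 ≤ supInnerBall K g := by
  have h0' : (0 : EuclideanSpace ℝ (Fin n)) ∈ K ∩ Metric.closedBall 0 1 := ⟨h0, by simp⟩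
  simpa [supInnerBall_eq_supportFun] using inner_le_supportFun norm_le_one_of_mem_inter_closedBall g h0'

theorem supInnerBall_le_infDist {K P : Set (EuclideanSpace ℝ (Fin n))} (h0 : 0 ∈ K)
    (hP : P.Nonempty) (h : ∀ t ∈ K, ∀ s ∈ P, inner ℝ s t ≤ 0) (g : EuclideanSpace ℝ (Fin n)) :
    supInnerBall K g ≤ Metric.infDist g P := by
  rw [supInnerBall_eq_supportFun]
  refine (Metric.le_infDist hP).2 fun {s} hs => supportFun_le (nonempty_inter_closedBall h0) fun t ht => ?_
  have h1 := h t ht.1 s hs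
  have h2 := (real_inner_le_norm (g - s) t).trans (mul_le_of_le_one_right (norm_nonneg _)
    (norm_le_one_of_mem_inter_closedBall t ht))
  rw [inner_sub_left] at h2
  rw [dist_eq_norm]
  linarith

theorem inner_nonpos_of_mem_priorRestrictedCone (hf : ∀ i, IsProperConvex (f i))
    {τ : EuclideanSpace ℝ (Fin (k + 1))} (hτ : τ ∈ orthant (k + 1))
    {s t : EuclideanSpace ℝ (Fin n)} (hs : s ∈ sumSubdiff f x τ)
    (ht : t ∈ priorRestrictedCone f x) : inner ℝ s t ≤ 0 := by
  obtain ⟨a, ha, hat⟩ := ht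
  obtain ⟨u, hu, rfl⟩ := mem_weightedSum.1 hs
  rw [sum_inner]
  refine Finset.sum_nonpos fun i _ => ?_
  rw [real_inner_smul_left]
  exact mul_nonpos_of_nonneg_of_nonpos (hτ i)
    (inner_nonpos_of_mem_descentCone (hf i) (hu i) ⟨a, ha, hat i⟩)

theorem statDim_priorRestrictedCone_le_J (hf : ∀ i, IsProperConvex (f i))
    (hne : ∀ i, (subdiff (f i) x).Nonempty) {τ : EuclideanSpace ℝ (Fin (k + 1))}
    (hτ : τ ∈ orthant (k + 1)) : statDim (priorRestrictedCone f x) ≤ J f x τ := by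
  refine integral_mono (memLp_supInnerBall zero_mem_priorRestrictedCone).integrable_sq
    (memLp_infDist IsGaussian.memLp_two_id _).integrable_sq fun g => ?_
  exact pow_le_pow_left₀ (supInnerBall_nonneg zero_mem_priorRestrictedCone g)
    (supInnerBall_le_infDist zero_mem_priorRestrictedCone (weightedSum_nonempty hne τ)
      (fun t ht s hs => inner_nonpos_of_mem_priorRestrictedCone hf hτ hs ht) g) 2

/-- A common relative interior point has negative inner product with every subgradient; compactness
of the finite union makes the bound uniform, as coercivity requires. -/
theorem exists_pos_forall_inner_le_neg (hf : ∀ i, IsProperConvex (f i))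
    (hcpt : ∀ i, IsCompact (subdiff (f i) x))
    (hzero : ∀ i, (0 : EuclideanSpace ℝ (Fin n)) ∉ subdiff (f i) x)
    (hri : (⋂ i, intrinsicInterior ℝ (descentCone (f i) x)).Nonempty) :
    ∃ (d : EuclideanSpace ℝ (Fin n)) (c : ℝ), 0 < c ∧
      ∀ i, ∀ u ∈ subdiff (f i) x, inner ℝ u d ≤ -c := by
  obtain ⟨d, hd⟩ := hri
  have hcompact : IsCompact (⋃ i, subdiff (f i) x) := isCompact_iUnion hcpt
  have hneg : ∀ u ∈ ⋃ i, subdiff (f i) x, 0 < -inner ℝ u d := fun u hu => by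
    obtain ⟨i, hi⟩ := mem_iUnion.1 hu
    exact neg_pos.2 (inner_neg_of_mem_intrinsicInterior_descentCone (hf i) (hcpt i) (hzero i) hi
      (mem_iInter.1 hd i))
  obtain ⟨c, hc, hcu⟩ := hcompact.exists_forall_le' (a := 0)
    (f := fun u => -inner ℝ u d) (by fun_prop) hneg
  exact ⟨d, c, hc, fun i u hu => le_neg_of_le_neg (hcu u (mem_iUnion.2 ⟨i, hu⟩))⟩

end StatisticalDimension

end PriorCone

theorem mainTheorem2 (n k : ℕ)
    (f : Fin (k + 1) → EuclideanSpace ℝ (Fin n) → EReal)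
    (hf : ∀ i, PriorCone.IsProperConvex (f i))
    (x : EuclideanSpace ℝ (Fin n))
    (hne : ∀ i, (PriorCone.subdiff (f i) x).Nonempty)
    (hcpt : ∀ i, IsCompact (PriorCone.subdiff (f i) x))
    (hzero : ∀ i, (0 : EuclideanSpace ℝ (Fin n)) ∉ PriorCone.subdiff (f i) x)
    (hri : (⋂ i, intrinsicInterior ℝ (PriorCone.descentCone (f i) x)).Nonempty) :
    -- the two expectations are finite
    Integrable (fun g => PriorCone.supInnerBall (PriorCone.priorRestrictedCone f x) g ^ 2)
      (stdGaussian (EuclideanSpace ℝ (Fin n))) ∧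
    (∀ τ ∈ PriorCone.orthant (k + 1),
      Integrable (fun g => Metric.infDist g (PriorCone.sumSubdiff f x τ) ^ 2)
        (stdGaussian (EuclideanSpace ℝ (Fin n)))) ∧
    -- the upper bound
    PriorCone.statDim (PriorCone.priorRestrictedCone f x) ≤
      ⨅ τ : PriorCone.orthant (k + 1), PriorCone.J f x τ ∧
    -- regularity
    ConvexOn ℝ (PriorCone.orthant (k + 1)) (PriorCone.J f x) ∧
    ContinuousOn (PriorCone.J f x) (PriorCone.orthant (k + 1)) ∧
    PriorCone.IsC1OnOrthant (PriorCone.J f x) ∧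
    -- the minimum over the orthant is attained, and all minimizers lie in a compact subset
    (∃ K : Set (EuclideanSpace ℝ (Fin (k + 1))), IsCompact K ∧ K ⊆ PriorCone.orthant (k + 1) ∧
      (∃ τ ∈ K, IsMinOn (PriorCone.J f x) (PriorCone.orthant (k + 1)) τ) ∧
      ∀ τ ∈ PriorCone.orthant (k + 1),
        IsMinOn (PriorCone.J f x) (PriorCone.orthant (k + 1)) τ → τ ∈ K) ∧
    -- strict convexity and uniqueness of the minimizer
    ((∀ τ ∈ PriorCone.orthant (k + 1), ∀ σ ∈ PriorCone.orthant (k + 1), τ ≠ σ →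
        PriorCone.sumSubdiff f x τ ≠ PriorCone.sumSubdiff f x σ) →
      StrictConvexOn ℝ (PriorCone.orthant (k + 1)) (PriorCone.J f x) ∧
      ∃! τ, τ ∈ PriorCone.orthant (k + 1) ∧
        IsMinOn (PriorCone.J f x) (PriorCone.orthant (k + 1)) τ) := by
  have hμ : MemLp id 2 (stdGaussian (EuclideanSpace ℝ (Fin n))) := IsGaussian.memLp_two_id
  -- For this family, `sumSubdiff` and `J` are `weightedSum` and `expSqDist` by definition.
  have h : PriorCone.IsNonemptyCompactConvexFamily fun i => PriorCone.subdiff (f i) x :=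
    ⟨hne, hcpt, fun i => (hf i).convex_subdiff⟩
  obtain ⟨d, c, hc, hd⟩ := PriorCone.exists_pos_forall_inner_le_neg hf hcpt hzero hri
  have hmin := h.exists_isCompact_isMinOn hμ hc hd
  refine ⟨(PriorCone.memLp_supInnerBall PriorCone.zero_mem_priorRestrictedCone).integrable_sq,
    fun τ _ => (PriorCone.memLp_infDist hμ _).integrable_sq, ?_, h.convexOn_expSqDist hμ,
    h.continuousOn_expSqDist hμ, h.isC1OnOrthant_expSqDist hμ, hmin, fun hinj => ?_⟩
  · have : Nonempty (PriorCone.orthant (k + 1)) := ⟨⟨0, PriorCone.zero_mem_orthant⟩⟩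
    exact le_ciInf fun τ => PriorCone.statDim_priorRestrictedCone_le_J hf hne τ.2
  · have hstrict := h.strictConvexOn_expSqDist hμ hinj
    obtain ⟨K, -, hK, ⟨τ, hτ, hτmin⟩, -⟩ := hmin
    exact ⟨hstrict, τ, ⟨hK hτ, hτmin⟩, fun σ hσ =>
      hstrict.eq_of_isMinOn hσ.2 hτmin hσ.1 (hK hτ)⟩
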